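/- Let $R$ be an integral domain with fraction field $K$. For fractional ideals $A,B$ of $R$ put $(A:B)=\{x\in K: xB\subseteq A\}$. For a nonzero fractional ideal $I$ of $R$ put $I^{-1}=(R:I)$, $I_v=(I^{-1})^{-1}$ and $I_t=\bigcup J_v$, where $J$ ranges over the nonzero finitely generated fractional ideals of $R$ contained in $I$; $I$ is a $t$-ideal if $I_t=I$. A maximal $t$-ideal is an ideal of $R$ that is maximal among the proper (integral) $t$-ideals of $R$; such an ideal is prime. The domain $R$ is $t$-locally Noetherian if the localization $R_M$ is Noetherian for every maximal $t$-ideal $M$ of $R$. The class semigroup $\mathcal S(R)$ is the multiplicative commutative semigroup of nonzero fractional ideals of $R$ modulo nonzero principal fractional ideals ($I\sim J$ iff $J=cI$ for some $0\neq c\in K$). The domain $R$ is Clifford regular if for every $x\in\mathcal S(R)$ there is $a\in\mathcal S(R)$ with $x^2a=x$, and Boole regular if $x^2=x$ for every $x\in\mathcal S(R)$. The domain $R$ is stable if every nonzero ideal $I$ of $R$ is an invertible ideal of the ring $(I:I)$, and strongly stable if every nonzero ideal $I$ of $R$ is a principal ideal of the ring $(I:I)$. **Theorem.** Let $R$ be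 a $t$-locally Noetherian domain. Then 1. $R$ is Clifford regular if and only if $R$ is stable; 2. $R$ is Boole regular if and only if $R$ is strongly stable; 3. if any one of these four conditions (Clifford regular, stable, Boole regular, strongly stable) holds, then $R$ is either a field or a one-dimensional Noetherian domain. -/

import Mathlib

open scoped nonZeroDivisors

/-! ### Clifford and Boolean semigroups -/

/-- A commutative semigroup is a Clifford semigroup if every element is von Neumann regular. -/
def IsCliffordSemigroup (S : Type*) [CommSemigroup S] : Prop :=
  ∀ x : S, ∃ a : S, x * x * a = x

/-- A commutative semigroup is Boolean if every element is idempotent. -/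
def IsBooleanSemigroup (S : Type*) [CommSemigroup S] : Prop :=
  ∀ x : S, x = x * x

/-! ### The class semigroup of a domain -/

section ClassSemigroup

variable (R : Type*) [CommRing R] [IsDomain R]

/-- The multiplicative monoid of nonzero fractional ideals of the domain `R`. -/
noncomputable def nonzeroFractionalIdeals : Submonoid (FractionalIdeal R⁰ (FractionRing R)) where
  carrier := {I | I ≠ 0}
  mul_mem' := by
    intro I J hI hJ h
    obtain ⟨x, hx, hx0⟩ := FractionalIdeal.exists_ne_zero_mem_isInteger hI
    obtain ⟨y, hy, hy0⟩ := FractionalIdeal.exists_ne_zero_mem_isInteger hJ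
    have hxy := FractionalIdeal.eq_zero_iff.mp h _ (FractionalIdeal.mul_mem_mul hx0 hy0)
    rw [← map_mul, IsFractionRing.to_map_eq_zero_iff] at hxy
    exact mul_ne_zero hx hy hxy
  one_mem' := one_ne_zero

/-- Two nonzero fractional ideals are identified if they differ by a nonzero principal
fractional ideal. -/
noncomputable def classSemigroupCon : Con (nonzeroFractionalIdeals R) where
  r I J := ∃ c : FractionRing R, c ≠ 0 ∧
    (J : FractionalIdeal R⁰ (FractionRing R)) =
      FractionalIdeal.spanSingleton R⁰ c * (I : FractionalIdeal R⁰ (FractionRing R))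
  iseqv := by
    refine ⟨fun I => ⟨1, one_ne_zero, by simp⟩, ?_, ?_⟩
    · rintro I J ⟨c, hc, h⟩
      refine ⟨c⁻¹, inv_ne_zero hc, ?_⟩
      rw [h, ← mul_assoc, FractionalIdeal.spanSingleton_mul_spanSingleton, inv_mul_cancel₀ hc]
      simp
    · rintro I J L ⟨c, hc, h⟩ ⟨d, hd, h'⟩
      refine ⟨d * c, mul_ne_zero hd hc, ?_⟩
      rw [h', h, ← mul_assoc, FractionalIdeal.spanSingleton_mul_spanSingleton]
  mul' := by
    rintro I J I' J' ⟨c, hc, h⟩ ⟨d, hd, h'⟩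
    refine ⟨c * d, mul_ne_zero hc hd, ?_⟩
    rw [Submonoid.coe_mul, Submonoid.coe_mul, h, h',
      ← FractionalIdeal.spanSingleton_mul_spanSingleton, mul_mul_mul_comm]

/-- The class semigroup of `R`: nonzero fractional ideals modulo nonzero principal ones, with the
multiplication induced by that of fractional ideals. -/
abbrev ClassSemigroup : Type _ := (classSemigroupCon R).Quotient

/-- `R` is Clifford regular if its class semigroup is a Clifford semigroup. -/
def IsCliffordRegular : Prop := IsCliffordSemigroup (ClassSemigroup R)

/-- `R` is Boole regular if its class semigroup is a Boolean semigroup. -/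
def IsBooleRegular : Prop := IsBooleanSemigroup (ClassSemigroup R)

end ClassSemigroup

/-! ### Stability -/

section Stability

variable {R : Type*} [CommRing R] [IsDomain R]

/-- The endomorphism ring `(I : I) = {x ∈ K | x I ⊆ I}` of an ideal `I` of `R`, an overring of `R`
inside the fraction field `K`. -/
def endRing (I : Ideal R) : Subalgebra R (FractionRing R) where
  carrier := {x | ∀ a ∈ I, ∃ b ∈ I, x * algebraMap R (FractionRing R) a = algebraMap R _ b}
  mul_mem' := by
    intro x y hx hy a ha
    obtain ⟨b, hb, h⟩ := hy a ha
    obtain ⟨c, hc, h'⟩ := hx b hb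
    exact ⟨c, hc, by rw [mul_assoc, h, h']⟩
  add_mem' := by
    intro x y hx hy a ha
    obtain ⟨b, hb, h⟩ := hx a ha
    obtain ⟨c, hc, h'⟩ := hy a ha
    exact ⟨b + c, I.add_mem hb hc, by rw [add_mul, h, h', map_add]⟩
  algebraMap_mem' r a ha := ⟨r * a, I.mul_mem_left r ha, (map_mul _ _ _).symm⟩

/-- The ideal `I` of `R`, viewed as an `(I : I)`-submodule of the fraction field of `R`. -/
def overEndRing (I : Ideal R) : Submodule (endRing I) (FractionRing R) where
  carrier := algebraMap R (FractionRing R) '' (I : Set R)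
  add_mem' := by
    rintro _ _ ⟨a, ha, rfl⟩ ⟨b, hb, rfl⟩
    exact ⟨a + b, I.add_mem ha hb, map_add _ _ _⟩
  zero_mem' := ⟨0, I.zero_mem, map_zero _⟩
  smul_mem' := by
    rintro ⟨x, hx⟩ _ ⟨a, ha, rfl⟩
    obtain ⟨b, hb, h⟩ := hx a ha
    exact ⟨b, hb, h.symm⟩

/-- `I` is stable if it is invertible as a (fractional) ideal of `(I : I)`, that is, `I * J = (I : I)`
for some `(I : I)`-submodule `J` of the fraction field. -/
def IsStableIdeal (I : Ideal R) : Prop :=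
  ∃ J : Submodule (endRing I) (FractionRing R), overEndRing I * J = 1

variable (R)

/-- `R` is stable if each of its nonzero ideals is stable. -/
def IsStableDomain : Prop := ∀ I : Ideal R, I ≠ ⊥ → IsStableIdeal I

/-- `R` is strongly stable if each of its nonzero ideals `I` is principal in `(I : I)`. -/
def IsStronglyStableDomain : Prop :=
  ∀ I : Ideal R, I ≠ ⊥ →
    ∃ c : FractionRing R, overEndRing I = Submodule.span (endRing I) {c}

end Stability

/-! ### The t-operation -/

section TOperation

variable {R : Type*} [CommRing R] [IsDomain R]

/-- `I_v = (I⁻¹)⁻¹`. -/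
noncomputable def vClosure (I : FractionalIdeal R⁰ (FractionRing R)) :
    FractionalIdeal R⁰ (FractionRing R) := (I⁻¹)⁻¹

/-- `I_t`, the union of the `J_v` over the nonzero finitely generated fractional ideals `J`
contained in `I`. -/
def tClosure (I : FractionalIdeal R⁰ (FractionRing R)) : Set (FractionRing R) :=
  {x | ∃ J : FractionalIdeal R⁰ (FractionRing R),
    J ≠ 0 ∧ (J : Submodule R (FractionRing R)).FG ∧ J ≤ I ∧ x ∈ vClosure J}

/-- A nonzero fractional ideal `I` is a t-ideal if `I_t = I`. -/
def IsTIdeal (I : FractionalIdeal R⁰ (FractionRing R)) : Prop :=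
  I ≠ 0 ∧ tClosure I = (I : Set (FractionRing R))

/-- A maximal t-ideal of `R`: an ideal maximal among the proper integral t-ideals. -/
def IsMaximalTIdeal (M : Ideal R) : Prop :=
  Maximal (fun I : Ideal R =>
    I ≠ ⊤ ∧ IsTIdeal (I : FractionalIdeal R⁰ (FractionRing R))) M

variable (R)

/-- `R` is t-locally Noetherian if `R_M` is Noetherian for each maximal t-ideal `M`. (Maximal
t-ideals are always prime; primality is listed here only so that `R_M` can be written.) -/
def IsTLocallyNoetherian : Prop :=
  ∀ (M : Ideal R) [M.IsPrime], IsMaximalTIdeal M → IsNoetherianRing (Localization.AtPrime M)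

end TOperation

/-! Clifford regularity says that every nonzero ideal `I` has a fractional ideal `J` with `I(IJ) =
I`. Then `IJ` is an ideal of `(I : I)` that reproduces `I`, so for finitely generated `I` Nakayama
gives `1 ∈ IJ`, and `I` is invertible over `(I : I)` (`Submodule.one_mem_mul_of_mul_mul_eq`). If
also `I² = cI`, then `I = c(IJ) = c(I : I)`. The converses hold in any domain, so it remains to show
that a Clifford regular `t`-locally Noetherian domain is Noetherian of dimension at most one.

Every nonzero maximal ideal `M` is a `t`-ideal (`one_notMem_vClosure`), hence each such `R_M` is
Noetherian. The extension of `M` to `R_M` is invertible over its multiplier ring, which is finite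
over `R_M`, and Krull's principal ideal theorem there bounds the height of `M` by one
(`Ideal.eq_of_le_of_one_mem_mul`). Finally `M` is finitely generated (`Ideal.fg_of_regular`), and
Cohen's theorem applies. -/

/-! ### Multiplier rings of submodules of a field -/

section MultiplierRing

variable {A K : Type*} [CommRing A] [Field K] [Algebra A K]

/-- The ring `(I : I) = {x ∈ K | x I ⊆ I}` of multipliers of an `A`-submodule `I` of `K`. -/
def Submodule.multiplierRing (I : Submodule A K) : Subalgebra A K where
  carrier := {x | ∀ a ∈ I, x * a ∈ I}
  mul_mem' hx hy a ha := by rw [mul_assoc]; exact hx _ (hy a ha)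
  add_mem' hx hy a ha := by rw [add_mul]; exact I.add_mem (hx a ha) (hy a ha)
  algebraMap_mem' r a ha := by rw [← Algebra.smul_def]; exact I.smul_mem r ha

namespace Submodule

variable {I J : Submodule A K}

theorem mem_multiplierRing_of_mem_mul (h : I * (I * J) = I) {x : K} (hx : x ∈ I * J) :
    x ∈ I.multiplierRing := fun a ha => by
  have := mul_mem_mul ha hx
  rwa [h, mul_comm] at this

theorem mul_mem_of_mem_multiplierRing {x y : K} (hx : x ∈ I.multiplierRing) (hy : y ∈ I * J) :
    x * y ∈ I * J := by
  induction hy using Submodule.mul_induction_on' with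
  | mem_mul_mem a ha b hb => rw [← mul_assoc]; exact mul_mem_mul (hx a ha) hb
  | add u _ v _ hu hv => rw [mul_add]; exact add_mem hu hv

/-- A finitely generated von Neumann regular submodule is invertible over its multiplier ring:
this is Nakayama's lemma over `(I : I)`. -/
theorem one_mem_mul_of_mul_mul_eq (hI : I.FG) (hI0 : I ≠ ⊥) (h : I * (I * J) = I) :
    (1 : K) ∈ I * J := by
  let B := I.multiplierRing
  let L : Ideal B :=
    { carrier := {b | (b : K) ∈ I * J}
      add_mem' := fun ha hb => (I * J).add_mem ha hb
      zero_mem' := zero_mem (I * J)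
      smul_mem' := fun c _ hb => mul_mem_of_mem_multiplierRing c.2 hb }
  let N : Submodule B K :=
    { carrier := I
      add_mem' := fun ha hb => I.add_mem ha hb
      zero_mem' := I.zero_mem
      smul_mem' := fun c _ hb => c.2 _ hb }
  have hN : N.FG := by
    obtain ⟨s, hs⟩ := hI
    refine ⟨s, le_antisymm (span_le.2 fun x hx => ?_) fun x hx => ?_⟩
    · change x ∈ I
      exact hs ▸ subset_span hx
    · have hx' : x ∈ span A (s : Set K) := hs ▸ hx
      exact span_le_restrictScalars A B (s : Set K) hx'
  have hNL : N ≤ L • N := by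
    intro x hx
    have hx' : x ∈ I * (I * J) := h.symm ▸ hx
    induction hx' using Submodule.mul_induction_on' with
    | mem_mul_mem a ha b hb =>
      rw [mul_comm]
      exact smul_mem_smul (r := (⟨b, mem_multiplierRing_of_mem_mul h hb⟩ : B)) (I := L) hb
        (show a ∈ N from ha)
    | add u hu v hv hu' hv' => exact add_mem (hu' (h.le hu)) (hv' (h.le hv))
  -- Nakayama yields `r ≡ 1` mod `L` killing `N`; in a field this forces `r = 0`, so `-1 ∈ L`.
  obtain ⟨r, hr, hr0⟩ := exists_sub_one_mem_and_smul_eq_zero_of_fg_of_le_smul L N hN hNL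
  obtain ⟨a, ha, ha0⟩ := I.exists_mem_ne_zero_of_ne_bot hI0
  have hra : (r : K) * a = 0 := hr0 a ha
  have hr' : (r : K) = 0 := (mul_eq_zero.1 hra).resolve_right ha0
  have hr1 : (r : K) - 1 ∈ I * J := hr
  rw [hr', zero_sub] at hr1
  simpa using neg_mem hr1

/-- Multiplication by a nonzero element of `I` embeds `(I : I)` into the Noetherian module `I`. -/
theorem finite_multiplierRing [IsNoetherianRing A] (hI : I.FG) (hI0 : I ≠ ⊥) :
    Module.Finite A I.multiplierRing := by
  obtain ⟨a, ha, ha0⟩ := I.exists_mem_ne_zero_of_ne_bot hI0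
  have : IsNoetherian A I := isNoetherian_of_fg_of_noetherian I hI
  let f : I.multiplierRing →ₗ[A] I :=
    { toFun := fun x => ⟨x * a, x.2 a ha⟩
      map_add' := fun x y => by ext; simp [add_mul]
      map_smul' := fun r x => by ext; simp }
  refine Module.Finite.of_injective f fun x y hxy => Subtype.ext ?_
  have : (x : K) * a = y * a := congrArg Subtype.val hxy
  exact mul_right_cancel₀ ha0 this

end Submodule

open IsLocalization in
/-- In a Noetherian domain, a maximal ideal that is invertible over its multiplier ring has height
at most one. -/
theorem Ideal.eq_of_le_of_one_mem_mul [IsDomain A] [IsNoetherianRing A] [FaithfulSMul A K]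
    {M : Ideal A} [M.IsMaximal] {J : Submodule A K}
    (h : coeSubmodule K M * (coeSubmodule K M * J) = coeSubmodule K M)
    (h1 : (1 : K) ∈ coeSubmodule K M * J) {P : Ideal A} [P.IsPrime] (hP : P ≠ ⊥) (hPM : P ≤ M) :
    P = M := by
  have hinj : Function.Injective (algebraMap A K) := FaithfulSMul.algebraMap_injective A K
  set I := coeSubmodule K M with hI
  have hI0 : I ≠ ⊥ := by
    rintro h0
    rw [h0, Submodule.bot_mul] at h1
    exact one_ne_zero ((Submodule.mem_bot A).1 h1)
  let E := I.multiplierRing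
  have : Module.Finite A E :=
    Submodule.finite_multiplierRing ((IsNoetherian.noetherian M).map _) hI0
  have : IsNoetherianRing E := IsNoetherianRing.of_finite A E
  have hker : RingHom.ker (algebraMap A E) = ⊥ :=
    (RingHom.injective_iff_ker_eq_bot _).1 (FaithfulSMul.algebraMap_injective A E)
  obtain ⟨Q, hQ, hQP⟩ := exists_ideal_over_prime_of_isIntegral_of_isDomain (S := E) P
    (hker.le.trans bot_le)
  -- Going up: `Q ≤ n` lie over `P ≤ M`, so it is enough to bound the height of `n`.
  obtain ⟨n, hQn, hn, hnM⟩ := exists_ideal_over_prime_of_isIntegral_of_isPrime (S := E) M Q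
    (hQP.le.trans hPM)
  -- Since `1` is a sum of products `m * j`, not all of them lie in the proper ideal `n`.
  have key : ∃ m ∈ M, ∃ j ∈ J, ∀ x ∈ n, (x : K) ≠ algebraMap A K m * j := by
    by_contra! hcon
    have : I * J ≤ (n.restrictScalars A).map E.val.toLinearMap := by
      rw [Submodule.mul_le]
      rintro _ ⟨m, hm, rfl⟩ j hj
      obtain ⟨x, hx, hxe⟩ := hcon m hm j hj
      exact ⟨x, hx, hxe⟩
    obtain ⟨x, hx, hx1⟩ := this h1
    have : x = 1 := Subtype.ext hx1
    exact hn.ne_top ((Ideal.eq_top_iff_one n).2 (this ▸ hx))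
  obtain ⟨m, hm, j, hj, hmj⟩ := key
  have hmE : ∀ a ∈ M, algebraMap A K a * j ∈ E := fun a ha =>
    Submodule.mem_multiplierRing_of_mem_mul h (Submodule.mul_mem_mul ⟨a, ha, rfl⟩ hj)
  -- For a prime `q ≤ n` containing `m`, the identity `a(mj) = m(aj)` with `mj ∉ q` puts every `a ∈
  -- M` in `q`; incomparability then gives `q = n`.
  have hmin : n ∈ (Ideal.span {algebraMap A E m}).minimalPrimes := by
    refine ⟨⟨hn, ?_⟩, fun q ⟨hq, hmq⟩ hqn => ?_⟩
    · rw [Ideal.span_singleton_le_iff_mem, ← Ideal.mem_comap, hnM]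
      exact hm
    · rw [Ideal.span_singleton_le_iff_mem] at hmq
      have hMq : M ≤ q.comap (algebraMap A E) := by
        intro a ha
        have h2 : algebraMap A E a * ⟨_, hmE m hm⟩ ∈ q := by
          have : algebraMap A E a * ⟨_, hmE m hm⟩ = algebraMap A E m * ⟨_, hmE a ha⟩ := by
            ext
            change algebraMap A K a * (algebraMap A K m * j)
              = algebraMap A K m * (algebraMap A K a * j)
            ring
          rw [this]
          exact q.mul_mem_right _ hmq
        exact (hq.mem_or_mem h2).resolve_right fun h3 => hmj _ (hqn h3) rfl
      by_contra hnq
      have hlt := IsIntegral.comap_lt_comap (R := A) (lt_of_le_not_ge hqn hnq)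
      rw [hnM] at hlt
      exact hlt.not_ge hMq
  have hht := Ideal.height_le_one_of_isPrincipal_of_mem_minimalPrimes _ n hmin
  by_contra hne
  have hQn' : Q < n := lt_of_le_of_ne hQn fun he => hne (by rw [← hQP, he, hnM])
  have hQ0 : ⊥ < Q := bot_lt_iff_ne_bot.2 fun he => hP (by rw [← hQP, he, ← hker]; rfl)
  have h2 := Ideal.height_add_one_le_of_lt_of_isPrime hQn'
  have h3 := Ideal.height_add_one_le_of_lt_of_isPrime hQ0
  have h4 : (1 : ℕ∞) ≤ Q.height := le_trans (by simp) h3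
  have h5 : (1 : ℕ∞) + 1 ≤ 1 := (add_le_add_left h4 1).trans (h2.trans hht)
  exact absurd h5 (by decide)

end MultiplierRing

/-! ### Regular ideals whose localization is Noetherian -/

section Localization

variable {R K : Type*} (A : Type*) [CommRing R] [CommRing A] [Field K] [Algebra R A] [Algebra A K]
  [Algebra R K] [IsScalarTower R A K]

open Submodule IsLocalization

theorem Submodule.span_coe_mul (I J : Submodule R K) :
    span A ((I * J : Submodule R K) : Set K) = span A (I : Set K) * span A (J : Set K) := by
  rw [mul_eq_span_mul_set, span_span_of_tower, span_mul_span]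

theorem IsLocalization.exists_smul_mem_of_mem_span (S : Submonoid R) [IsLocalization S A]
    {N : Submodule R K} {x : K} (hx : x ∈ span A (N : Set K)) : ∃ s ∈ S, s • x ∈ N := by
  induction hx using Submodule.span_induction with
  | mem x hx => exact ⟨1, S.one_mem, by rwa [one_smul]⟩
  | zero => exact ⟨1, S.one_mem, by simp⟩
  | add x y _ _ hx hy =>
    obtain ⟨s, hs, hsx⟩ := hx
    obtain ⟨t, ht, hty⟩ := hy
    refine ⟨s * t, S.mul_mem hs ht, ?_⟩
    rw [smul_add]
    refine N.add_mem ?_ ?_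
    · rw [mul_comm, mul_smul]; exact N.smul_mem t hsx
    · rw [mul_smul]; exact N.smul_mem s hty
  | smul a x _ hx =>
    obtain ⟨s, hs, hsx⟩ := hx
    obtain ⟨⟨r, t⟩, hrt⟩ := IsLocalization.surj S a
    refine ⟨s * t, S.mul_mem hs t.2, ?_⟩
    have : (s * (t : R)) • a • x = r • s • x := by
      rw [mul_smul, ← algebraMap_smul A (t : R), ← mul_smul (algebraMap R A t), mul_comm _ a, hrt,
        algebraMap_smul, smul_comm]
    rw [this]
    exact N.smul_mem r hsx

theorem IsLocalization.coeSubmodule_map (I : Ideal R) :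
    coeSubmodule K (I.map (algebraMap R A)) = span A (coeSubmodule K I : Set K) := by
  rw [Ideal.map, coeSubmodule_span, ← Set.image_comp, ← RingHom.coe_comp,
    ← IsScalarTower.algebraMap_eq]
  rfl

variable {A}
variable {M : Ideal R} {J : Submodule R K}

theorem coeSubmodule_map_regular
    (h : coeSubmodule K M * (coeSubmodule K M * J) = coeSubmodule K M) :
    coeSubmodule K (M.map (algebraMap R A)) *
        (coeSubmodule K (M.map (algebraMap R A)) * span A (J : Set K)) =
      coeSubmodule K (M.map (algebraMap R A)) := by
  rw [coeSubmodule_map, ← span_coe_mul, ← span_coe_mul, h]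

theorem exists_fg_of_mem_coeSubmodule_mul {x : K} (hx : x ∈ coeSubmodule K M * J) :
    ∃ I : Ideal R, I.FG ∧ I ≤ M ∧ x ∈ coeSubmodule K I * J := by
  induction hx using Submodule.mul_induction_on' with
  | mem_mul_mem a ha b hb =>
    obtain ⟨a, ha, rfl⟩ := ha
    refine ⟨Ideal.span {a}, fg_span_singleton a, (Ideal.span_singleton_le_iff_mem _).2 ha,
      mul_mem_mul ⟨a, Ideal.mem_span_singleton_self a, rfl⟩ hb⟩
  | add u _ v _ hu hv =>
    obtain ⟨I, hI, hIM, hu⟩ := hu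
    obtain ⟨I', hI', hIM', hv⟩ := hv
    exact ⟨I ⊔ I', Submodule.FG.sup hI hI', sup_le hIM hIM',
      add_mem (mul_le_mul' (coeSubmodule_mono K le_sup_left) le_rfl hu)
        (mul_le_mul' (coeSubmodule_mono K le_sup_right) le_rfl hv)⟩

variable [FaithfulSMul R K]

/-- The equation `M(MJ) = M` survives extension to `A`, where the extended ideal is finitely
generated and Nakayama applies. -/
theorem one_mem_span_of_regular [IsNoetherianRing A] (hM : M ≠ ⊥)
    (h : coeSubmodule K M * (coeSubmodule K M * J) = coeSubmodule K M) :
    (1 : K) ∈ coeSubmodule K (M.map (algebraMap R A)) * span A (J : Set K) := by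
  refine one_mem_mul_of_mul_mul_eq ((IsNoetherian.noetherian _).map _) ?_
    (coeSubmodule_map_regular h)
  obtain ⟨x, hx, hx0⟩ := M.exists_mem_ne_zero_of_ne_bot hM
  intro h0
  have hx' : algebraMap R K x ∈ coeSubmodule K (M.map (algebraMap R A)) := by
    rw [coeSubmodule_map]
    exact subset_span ⟨x, hx, rfl⟩
  rw [h0, mem_bot, FaithfulSMul.algebraMap_eq_zero_iff] at hx'
  exact hx0 hx'

/-- A regular maximal ideal whose localization is Noetherian is invertible over its multiplier
ring. -/
theorem one_mem_of_regular (A : Type*) [CommRing A] [Algebra R A] [Algebra A K]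
    [IsScalarTower R A K] [IsNoetherianRing A] [hmax : M.IsMaximal]
    [IsLocalization.AtPrime A M] (hM : M ≠ ⊥)
    (h : coeSubmodule K M * (coeSubmodule K M * J) = coeSubmodule K M) :
    (1 : K) ∈ coeSubmodule K M * J := by
  have h1 := one_mem_span_of_regular (A := A) hM h
  rw [coeSubmodule_map, ← span_coe_mul] at h1
  obtain ⟨s, hs, hs1⟩ := exists_smul_mem_of_mem_span A M.primeCompl h1
  let 𝔞 : Ideal R := (coeSubmodule K M * J).comap (Algebra.linearMap R K)
  -- `M = M(MJ) ⊆ MJ`, so the ideal `MJ ∩ R` contains `M` as well as some `s ∉ M`; by maximality it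
  -- is `R`.
  have hM𝔞 : M ≤ 𝔞 := by
    intro x hx
    change algebraMap R K x ∈ coeSubmodule K M * J
    have hx' : algebraMap R K x ∈ coeSubmodule K M * (coeSubmodule K M * J) := by
      rw [h]; exact ⟨x, hx, rfl⟩
    have hle : coeSubmodule K M * (coeSubmodule K M * J) ≤ coeSubmodule K M * J := mul_le.2 ?_
    · exact hle hx'
    rintro _ ⟨a, -, rfl⟩ y hy
    change algebraMap R K a * y ∈ coeSubmodule K M * J
    rw [← Algebra.smul_def]
    exact smul_mem _ a hy
  have hs𝔞 : s ∈ 𝔞 := by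
    change algebraMap R K s ∈ coeSubmodule K M * J
    rwa [Algebra.algebraMap_eq_smul_one]
  have htop : 𝔞 = ⊤ := by
    by_contra hne
    exact hs ((hmax.eq_of_le hne hM𝔞).symm ▸ hs𝔞)
  have : (1 : R) ∈ 𝔞 := htop ▸ mem_top
  simpa [𝔞] using this

/-- Primes inside `M` are recovered from their extensions to `A`, so the height bound can be checked
there. -/
theorem prime_eq_of_le_of_regular (A : Type*) [CommRing A] [Algebra R A] [Algebra A K]
    [IsScalarTower R A K] [IsNoetherianRing A] [M.IsPrime]
    [IsLocalization.AtPrime A M] [IsDomain A] [FaithfulSMul A K] (hM : M ≠ ⊥)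
    (h : coeSubmodule K M * (coeSubmodule K M * J) = coeSubmodule K M)
    {P : Ideal R} [hPp : P.IsPrime] (hP : P ≠ ⊥) (hPM : P ≤ M) : P = M := by
  have : IsLocalRing A := IsLocalization.AtPrime.isLocalRing A M
  have hMm : M.map (algebraMap R A) = IsLocalRing.maximalIdeal A :=
    IsLocalization.AtPrime.map_eq_maximalIdeal M A
  have : (M.map (algebraMap R A)).IsMaximal := hMm ▸ IsLocalRing.maximalIdeal.isMaximal A
  have hdisj : ∀ Q : Ideal R, Q ≤ M → Disjoint (M.primeCompl : Set R) Q := fun Q hQ =>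
    Set.disjoint_left.2 fun x hx hxQ => hx (hQ hxQ)
  have : (P.map (algebraMap R A)).IsPrime :=
    isPrime_of_isPrime_disjoint M.primeCompl A P hPp (hdisj P hPM)
  have hcomap := under_map_of_isPrime_disjoint M.primeCompl A hPp (hdisj P hPM)
  have hcomapM := under_map_of_isPrime_disjoint M.primeCompl A (I := M) inferInstance
    (hdisj M le_rfl)
  have hP0 : P.map (algebraMap R A) ≠ ⊥ := by
    obtain ⟨x, hx, hx0⟩ := P.exists_mem_ne_zero_of_ne_bot hP
    intro h0
    have hx' : algebraMap R A x = 0 := by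
      have := Ideal.mem_map_of_mem (algebraMap R A) hx
      rwa [h0, Ideal.mem_bot] at this
    have : algebraMap R K x = 0 := by
      rw [IsScalarTower.algebraMap_apply R A K, hx', map_zero]
    exact hx0 ((FaithfulSMul.algebraMap_eq_zero_iff R K).1 this)
  have key := Ideal.eq_of_le_of_one_mem_mul (coeSubmodule_map_regular (A := A) h)
    (one_mem_span_of_regular hM h) hP0 (Ideal.map_mono hPM)
  rw [← hcomap, key, hcomapM]

/-- A finitely generated ideal over which `1` becomes invertible is contained in no maximal ideal
other than `M`. -/
theorem le_of_le_prime_of_one_mem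
    (h : coeSubmodule K M * (coeSubmodule K M * J) = coeSubmodule K M)
    {I : Ideal R} (h1 : (1 : K) ∈ coeSubmodule K I * J) {N : Ideal R} [hN : N.IsPrime]
    (hIN : I ≤ N) : M ≤ N := by
  intro s hs
  -- `s²J ⊆ M(MJ) = M ⊆ R`, hence `s²(IJ) ⊆ I`; as `1 ∈ IJ`, this gives `s² ∈ I ≤ N`.
  have hsJ : ∀ j ∈ J, ∃ r : R, algebraMap R K r = algebraMap R K s * (algebraMap R K s * j) := by
    intro j hj
    have : algebraMap R K s * (algebraMap R K s * j) ∈ coeSubmodule K M := by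
      rw [← h]
      exact mul_mem_mul ⟨s, hs, rfl⟩ (mul_mem_mul ⟨s, hs, rfl⟩ hj)
    obtain ⟨r, -, hr⟩ := this
    exact ⟨r, hr⟩
  have key : ∀ x ∈ coeSubmodule K I * J,
      algebraMap R K s * (algebraMap R K s * x) ∈ coeSubmodule K I := by
    intro x hx
    induction hx using Submodule.mul_induction_on' with
    | mem_mul_mem a ha b hb =>
      obtain ⟨r, hr⟩ := hsJ b hb
      have : algebraMap R K s * (algebraMap R K s * (a * b)) = r • a := by
        rw [Algebra.smul_def, hr]; ring
      rw [this]
      exact smul_mem _ r ha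
    | add u _ v _ hu hv => rw [mul_add, mul_add]; exact add_mem hu hv
  obtain ⟨y, hy, hys⟩ := key 1 h1
  have hys' : y = s * s := FaithfulSMul.algebraMap_injective R K (by
    rw [map_mul]; simpa using hys)
  have : s * s ∈ N := hys' ▸ hIN hy
  exact (hN.mem_or_mem this).elim id id

/-- A regular maximal ideal whose localization is Noetherian is finitely generated. -/
theorem Ideal.fg_of_regular (A : Type*) [CommRing A] [Algebra R A] [Algebra A K]
    [IsScalarTower R A K] [IsNoetherianRing A] [hmax : M.IsMaximal]
    [IsLocalization.AtPrime A M] (hM : M ≠ ⊥)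
    (h : coeSubmodule K M * (coeSubmodule K M * J) = coeSubmodule K M) : M.FG := by
  classical
  obtain ⟨I₁, hI₁, hI₁M, h1⟩ := exists_fg_of_mem_coeSubmodule_mul (one_mem_of_regular A hM h)
  obtain ⟨t, htM, ht⟩ := (fg_span_iff_fg_span_finset_subset (R := A)
    (algebraMap R A '' (M : Set R))).1 (IsNoetherian.noetherian _)
  obtain ⟨t, htM', rfl⟩ := Finset.subset_set_image_iff.1 htM
  let I₂ : Ideal R := Ideal.span (t : Set R)
  have hI₂ : I₂.map (algebraMap R A) = M.map (algebraMap R A) := by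
    rw [Ideal.map_span]
    exact (ht.trans (by rw [Finset.coe_image])).symm
  -- Checked locally: `I₁` lies in no maximal ideal but `M`, and at `M` itself `I₂` already
  -- generates the extension of `M`.
  have hle : M = I₁ ⊔ I₂ := by
    refine le_antisymm (fun x hx => ?_) (sup_le hI₁M (Ideal.span_le.2 htM'))
    let 𝔠 : Ideal R := Submodule.comap (LinearMap.toSpanSingleton R R x) (I₁ ⊔ I₂)
    suffices 𝔠 = ⊤ by
      have : (1 : R) ∈ 𝔠 := this ▸ mem_top
      simpa [𝔠] using this
    by_contra hne
    obtain ⟨N, hN, h𝔠N⟩ := Ideal.exists_le_maximal 𝔠 hne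
    have hMN : M ≤ N := le_of_le_prime_of_one_mem h h1 fun y hy =>
      h𝔠N (Ideal.mul_mem_right x _ (le_sup_left (b := I₂) hy) : y * x ∈ I₁ ⊔ I₂)
    obtain rfl := hmax.eq_of_le hN.ne_top hMN
    have hxA : algebraMap R A x ∈ I₂.map (algebraMap R A) :=
      hI₂ ▸ Ideal.mem_map_of_mem _ hx
    obtain ⟨s, hs, hsx⟩ := (algebraMap_mem_map_algebraMap_iff M.primeCompl A _ _).1 hxA
    exact hs (h𝔠N (le_sup_right (a := I₁) hsx : s * x ∈ I₁ ⊔ I₂))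
  rw [hle]
  exact Submodule.FG.sup hI₁ ⟨t, rfl⟩

end Localization

section Regularity

variable {R : Type*} [CommRing R]

open FractionalIdeal

local notation "K" => FractionRing R

theorem FractionalIdeal.ne_zero_of_spanSingleton_mul_eq {c : K} {I J : FractionalIdeal R⁰ K}
    (hI : I ≠ 0) (h : I = spanSingleton R⁰ c * J) : c ≠ 0 := by
  rintro rfl
  exact hI (by rw [h, spanSingleton_zero, zero_mul])

/-! ### Stable ideals -/

theorem mem_endRing_iff {I : Ideal R} {x : K} :
    x ∈ endRing I ↔ ∀ a ∈ (I : FractionalIdeal R⁰ K), x * a ∈ (I : FractionalIdeal R⁰ K) := by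
  simp only [mem_coeIdeal]
  constructor
  · rintro h _ ⟨a, ha, rfl⟩
    obtain ⟨b, hb, hab⟩ := h a ha
    exact ⟨b, hb, hab.symm⟩
  · intro h a ha
    obtain ⟨b, hb, hab⟩ := h _ ⟨a, ha, rfl⟩
    exact ⟨b, hb, hab.symm⟩

theorem mem_overEndRing_iff {I : Ideal R} {x : K} :
    x ∈ overEndRing I ↔ x ∈ (I : FractionalIdeal R⁰ K) :=
  (mem_coeIdeal R⁰).symm

theorem mem_one_endRing_iff {I : Ideal R} {x : K} :
    x ∈ (1 : Submodule (endRing I) K) ↔ x ∈ endRing I := by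
  rw [Submodule.mem_one]
  exact ⟨by rintro ⟨e, rfl⟩; exact e.2, fun h => ⟨⟨x, h⟩, rfl⟩⟩

theorem mem_endRing_of_mem_mul {I : Ideal R} {J : FractionalIdeal R⁰ K}
    (h : (I : FractionalIdeal R⁰ K) * (I * J) = I) {x : K}
    (hx : x ∈ (I : FractionalIdeal R⁰ K) * J) : x ∈ endRing I := by
  rw [mem_endRing_iff]
  intro a ha
  rw [mul_comm, ← h]
  exact mul_mem_mul ha hx

theorem isStableIdeal_of_one_mem {I : Ideal R} {J : FractionalIdeal R⁰ K}
    (h : (I : FractionalIdeal R⁰ K) * (I * J) = I)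
    (h1 : (1 : K) ∈ (I : FractionalIdeal R⁰ K) * J) : IsStableIdeal I := by
  refine ⟨Submodule.span (endRing I) (J : Set K), le_antisymm ?_ ?_⟩
  · have hI : overEndRing I = Submodule.span (endRing I) (overEndRing I : Set K) :=
      (Submodule.span_eq _).symm
    rw [hI, Submodule.span_mul_span, Submodule.span_le]
    rintro _ ⟨a, ha, j, hj, rfl⟩
    exact mem_one_endRing_iff.2
      (mem_endRing_of_mem_mul h (mul_mem_mul (mem_overEndRing_iff.1 ha) hj))
  · rw [Submodule.one_le]
    exact FractionalIdeal.mul_induction_on h1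
      (fun a ha j hj => Submodule.mul_mem_mul (mem_overEndRing_iff.2 ha) (Submodule.subset_span hj))
      fun u v hu hv => add_mem hu hv

/-- Multiplying `I² = cI` by `J` gives `I = c(IJ)`, and `IJ` consists of multipliers and contains
`1`. -/
theorem overEndRing_eq_span_singleton_of_one_mem {I : Ideal R} {J : FractionalIdeal R⁰ K} {c : K}
    (h : (I : FractionalIdeal R⁰ K) * (I * J) = I)
    (h1 : (1 : K) ∈ (I : FractionalIdeal R⁰ K) * J)
    (hc : (I : FractionalIdeal R⁰ K) * I = spanSingleton R⁰ c * I) :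
    overEndRing I = Submodule.span (endRing I) {c} := by
  have hcI : spanSingleton R⁰ c * ((I : FractionalIdeal R⁰ K) * J) = I := by
    rw [← mul_assoc, ← hc, mul_assoc, h]
  refine le_antisymm (fun x hx => ?_) ?_
  · rw [mem_overEndRing_iff, ← hcI, mem_singleton_mul] at hx
    obtain ⟨y, hy, rfl⟩ := hx
    rw [Submodule.mem_span_singleton]
    exact ⟨⟨y, mem_endRing_of_mem_mul h hy⟩, mul_comm y c⟩
  · rw [Submodule.span_singleton_le_iff_mem, mem_overEndRing_iff, ← hcI]
    simpa using mul_mem_mul (mem_spanSingleton_self R⁰ c) h1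

/-! ### Regularity of the class semigroup in terms of ideals -/

variable [IsDomain R]

theorem isCliffordRegular_iff :
    IsCliffordRegular R ↔
      ∀ I : FractionalIdeal R⁰ K, I ≠ 0 → ∃ J : FractionalIdeal R⁰ K, I * (I * J) = I := by
  constructor
  · intro h I hI
    obtain ⟨a, ha⟩ := h ((⟨I, hI⟩ : nonzeroFractionalIdeals R) : ClassSemigroup R)
    induction a using Con.induction_on with
    | H J =>
      obtain ⟨c, -, hc⟩ := (Con.eq (classSemigroupCon R)).1 ha
      -- The principal factor relating the two classes is absorbed into `J`.
      refine ⟨spanSingleton R⁰ c * J, ?_⟩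
      conv_rhs => rw [show I = _ from hc]
      simp only [Submonoid.coe_mul]
      ring
  · intro h x
    induction x using Con.induction_on with
    | H I =>
      obtain ⟨J, hJ⟩ := h I I.2
      have hJ0 : J ≠ 0 := by
        rintro rfl
        exact I.2 (by rw [← hJ, mul_zero, mul_zero])
      refine ⟨((⟨J, hJ0⟩ : nonzeroFractionalIdeals R) : ClassSemigroup R), ?_⟩
      refine (Con.eq (classSemigroupCon R)).2 ⟨1, one_ne_zero, ?_⟩
      simp only [Submonoid.coe_mul, spanSingleton_one, one_mul]
      rw [mul_assoc, hJ]

theorem isBooleRegular_iff :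
    IsBooleRegular R ↔
      ∀ I : FractionalIdeal R⁰ K, I ≠ 0 → ∃ c : K, I * I = spanSingleton R⁰ c * I := by
  constructor
  · intro h I hI
    obtain ⟨c, -, hc⟩ := (Con.eq (classSemigroupCon R)).1
      (h ((⟨I, hI⟩ : nonzeroFractionalIdeals R) : ClassSemigroup R))
    exact ⟨c, hc⟩
  · intro h x
    induction x using Con.induction_on with
    | H I =>
      obtain ⟨c, hc⟩ := h I I.2
      exact (Con.eq (classSemigroupCon R)).2
        ⟨c, ne_zero_of_spanSingleton_mul_eq ((I * I : nonzeroFractionalIdeals R).2) hc, hc⟩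

theorem isCliffordRegular_iff_ideal :
    IsCliffordRegular R ↔ ∀ I : Ideal R, I ≠ ⊥ →
      ∃ J : FractionalIdeal R⁰ K, (I : FractionalIdeal R⁰ K) * (I * J) = I := by
  rw [isCliffordRegular_iff]
  refine ⟨fun h I hI => h I (coeIdeal_ne_zero.2 hI), fun h I hI => ?_⟩
  obtain ⟨a, 𝔞, ha, rfl⟩ := exists_eq_spanSingleton_mul I
  have ha' : algebraMap R K a ≠ 0 := by simpa using ha
  obtain ⟨J, hJ⟩ := h 𝔞 (by rintro rfl; exact hI (by simp))
  refine ⟨spanSingleton R⁰ (algebraMap R K a) * J, ?_⟩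
  have hu : spanSingleton R⁰ (algebraMap R K a)⁻¹ * spanSingleton R⁰ (algebraMap R K a) = 1 := by
    rw [spanSingleton_mul_spanSingleton, inv_mul_cancel₀ ha', spanSingleton_one]
  generalize spanSingleton R⁰ (algebraMap R K a)⁻¹ = u at *
  generalize spanSingleton R⁰ (algebraMap R K a) = v at *
  calc u * (𝔞 : FractionalIdeal R⁰ K) * (u * 𝔞 * (v * J))
      = u * (u * v) * (𝔞 * (𝔞 * J)) := by ring
    _ = u * 𝔞 := by rw [hu, hJ, mul_one]

theorem isBooleRegular_iff_ideal :
    IsBooleRegular R ↔ ∀ I : Ideal R, I ≠ ⊥ →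
      ∃ c : K, (I : FractionalIdeal R⁰ K) * I = spanSingleton R⁰ c * I := by
  rw [isBooleRegular_iff]
  refine ⟨fun h I hI => h I (coeIdeal_ne_zero.2 hI), fun h I hI => ?_⟩
  obtain ⟨a, 𝔞, ha, rfl⟩ := exists_eq_spanSingleton_mul I
  obtain ⟨c, hc⟩ := h 𝔞 (by rintro rfl; exact hI (by simp))
  refine ⟨(algebraMap R K a)⁻¹ * c, ?_⟩
  rw [mul_mul_mul_comm, hc, ← spanSingleton_mul_spanSingleton]
  ring

theorem IsBooleRegular.isCliffordRegular (h : IsBooleRegular R) : IsCliffordRegular R :=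
  fun x => ⟨x, by rw [← h x]; exact (h x).symm⟩

/-! ### Stability and regularity -/

theorem IsStableIdeal.exists_mul_mul_eq {I : Ideal R} (hI : I ≠ ⊥) (h : IsStableIdeal I) :
    ∃ J : FractionalIdeal R⁰ K, (I : FractionalIdeal R⁰ K) * (I * J) = I := by
  obtain ⟨J, hJ⟩ := h
  have hmul : ∀ x ∈ (I : FractionalIdeal R⁰ K), ∀ j ∈ J, x * j ∈ endRing I := fun x hx j hj => by
    rw [← mem_one_endRing_iff, ← hJ]
    exact Submodule.mul_mem_mul (mem_overEndRing_iff.2 hx) hj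
  obtain ⟨x, hx, hx0⟩ := I.exists_mem_ne_zero_of_ne_bot hI
  have hfrac : IsFractional R⁰ (J.restrictScalars R) := by
    -- The inverse `J` is a priori any `(I : I)`-submodule of `K`; for `x ∈ I` one has `x²J ⊆ x(I :
    -- I) ⊆ I ⊆ R`.
    refine ⟨x * x, mem_nonZeroDivisors_of_ne_zero (mul_ne_zero hx0 hx0), fun j hj => ?_⟩
    have hxI := mem_coeIdeal_of_mem (P := K) R⁰ hx
    have := mem_endRing_iff.1 (hmul _ hxI j hj) _ hxI
    obtain ⟨y, -, hy⟩ := (mem_coeIdeal R⁰).1 this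
    exact ⟨y, by rw [hy, Algebra.smul_def, map_mul]; ring⟩
  let L : FractionalIdeal R⁰ K := ⟨J.restrictScalars R, hfrac⟩
  refine ⟨L, le_antisymm ?_ ?_⟩
  · rw [mul_le]
    intro a ha y hy
    suffices y ∈ endRing I by rw [mul_comm]; exact mem_endRing_iff.1 this a ha
    exact FractionalIdeal.mul_induction_on hy hmul fun u v hu hv => add_mem hu hv
  · intro a ha
    have hle : ∀ x ∈ overEndRing I * J, x ∈ (I : FractionalIdeal R⁰ K) * L := fun x hx => by
      induction hx using Submodule.mul_induction_on' with
      | mem_mul_mem i hi j hj => exact mul_mem_mul (mem_overEndRing_iff.1 hi) hj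
      | add u _ v _ hu hv =>
        exact Submodule.add_mem
          (((I : FractionalIdeal R⁰ K) * L : FractionalIdeal R⁰ K) : Submodule R K) hu hv
    have h1 : (1 : K) ∈ (I : FractionalIdeal R⁰ K) * L :=
      hle 1 (hJ ▸ mem_one_endRing_iff.2 (one_mem _))
    simpa using mul_mem_mul ha h1

theorem IsStableDomain.isCliffordRegular (h : IsStableDomain R) : IsCliffordRegular R :=
  isCliffordRegular_iff_ideal.2 fun I hI => (h I hI).exists_mul_mul_eq hI

theorem IsStronglyStableDomain.isBooleRegular (h : IsStronglyStableDomain R) :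
    IsBooleRegular R := by
  refine isBooleRegular_iff_ideal.2 fun I hI => ?_
  obtain ⟨c, hc⟩ := h I hI
  have hmem : ∀ x, x ∈ (I : FractionalIdeal R⁰ K) ↔ ∃ e ∈ endRing I, e * c = x := fun x => by
    rw [← mem_overEndRing_iff, hc, Submodule.mem_span_singleton]
    exact ⟨by rintro ⟨e, rfl⟩; exact ⟨e, e.2, rfl⟩, by rintro ⟨e, he, rfl⟩; exact ⟨⟨e, he⟩, rfl⟩⟩
  refine ⟨c, le_antisymm ?_ ?_⟩
  · rw [mul_le]
    intro x hx y hy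
    obtain ⟨e, he, rfl⟩ := (hmem x).1 hx
    rw [mul_comm e, mul_assoc]
    exact mul_mem_mul (mem_spanSingleton_self _ _) (mem_endRing_iff.1 he y hy)
  · refine mul_le_mul_left ?_ _
    rw [spanSingleton_le_iff_mem, hmem]
    exact ⟨1, one_mem _, one_mul c⟩

theorem FractionalIdeal.one_mem_mul_of_mul_mul_eq {I J : FractionalIdeal R⁰ K} (hI : I ≠ 0)
    (hfg : (I : Submodule R K).FG) (h : I * (I * J) = I) : (1 : K) ∈ I * J := by
  rw [← mem_coe, coe_mul]
  refine Submodule.one_mem_mul_of_mul_mul_eq hfg (fun h0 => hI (coeToSubmodule_eq_bot.1 h0)) ?_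
  rw [← coe_mul, ← coe_mul, h]

theorem IsCliffordRegular.isStableDomain [IsNoetherianRing R] (h : IsCliffordRegular R) :
    IsStableDomain R := fun I hI => by
  obtain ⟨J, hJ⟩ := isCliffordRegular_iff_ideal.1 h I hI
  exact isStableIdeal_of_one_mem hJ (one_mem_mul_of_mul_mul_eq (coeIdeal_ne_zero.2 hI)
    (fg_of_isNoetherianRing le_rfl _) hJ)

theorem IsBooleRegular.isStronglyStableDomain [IsNoetherianRing R] (h : IsBooleRegular R) :
    IsStronglyStableDomain R := fun I hI => by
  obtain ⟨J, hJ⟩ := isCliffordRegular_iff_ideal.1 h.isCliffordRegular I hI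
  obtain ⟨c, hc⟩ := isBooleRegular_iff_ideal.1 h I hI
  exact ⟨c, overEndRing_eq_span_singleton_of_one_mem hJ (one_mem_mul_of_mul_mul_eq
    (coeIdeal_ne_zero.2 hI) (fg_of_isNoetherianRing le_rfl _) hJ) hc⟩

/-! ### Maximal ideals of Clifford regular domains -/

theorem le_vClosure {I : FractionalIdeal R⁰ K} (hI : I ≠ 0) (hI' : I⁻¹ ≠ 0) :
    I ≤ vClosure I := fun x hx => by
  rw [vClosure, mem_inv_iff hI']
  intro y hy
  rw [mul_comm]
  exact (mem_inv_iff hI).1 hy x hx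

theorem vClosure_mono {I J : FractionalIdeal R⁰ K} (hI : I ≠ 0) (hJ : J ≠ 0) (hJ' : J⁻¹ ≠ 0)
    (hIJ : I ≤ J) : vClosure I ≤ vClosure J := by
  have h := inv_anti_mono hI hJ hIJ
  exact inv_anti_mono hJ' (fun h0 => hJ' (by rw [h0] at h; exact le_bot_iff.1 h)) h

theorem FractionalIdeal.inv_ne_zero_of_ne_zero {I : FractionalIdeal R⁰ K} (hI : I ≠ 0) :
    I⁻¹ ≠ 0 := fun h => by
  have := bot_lt_mul_inv hI
  rw [h, mul_zero] at this
  exact lt_irrefl _ this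

/-- If `1 ∈ J_v` then `J⁻¹ ⊆ R`. Regularity `J(JL) = J ⊆ R` gives `JL ⊆ J⁻¹ ⊆ R`, so `L ⊆ J⁻¹ ⊆ R`
and `JL ⊆ J`. By Nakayama `1 ∈ JL ⊆ J`, which is impossible inside a proper ideal. -/
theorem one_notMem_vClosure (h : IsCliffordRegular R) {N : Ideal R} (hN : N ≠ ⊤)
    {J : FractionalIdeal R⁰ K} (hJ : J ≠ 0) (hfg : (J : Submodule R K).FG) (hJN : J ≤ N) :
    (1 : K) ∉ vClosure J := by
  intro h1
  have hinv : J⁻¹ ≤ 1 := fun y hy => by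
    have := (mem_inv_iff (inv_ne_zero_of_ne_zero hJ)).1 h1 y hy
    rwa [one_mul] at this
  obtain ⟨L, hL⟩ := isCliffordRegular_iff.1 h J hJ
  have hJ1 : J ≤ 1 := hJN.trans coeIdeal_le_one
  have hJL : J * L ≤ J⁻¹ := by
    rw [inv_eq, le_div_iff_mul_le hJ, mul_comm, hL]
    exact hJ1
  have hLinv : L ≤ J⁻¹ := by
    rw [inv_eq, le_div_iff_mul_le hJ, mul_comm]
    exact hJL.trans hinv
  have h1J : (1 : K) ∈ J := by
    have h2 : J * L ≤ J * 1 := mul_le_mul_right (hLinv.trans hinv) J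
    rw [mul_one] at h2
    exact h2 (FractionalIdeal.one_mem_mul_of_mul_mul_eq hJ hfg hL)
  obtain ⟨r, hr, hr1⟩ := (mem_coeIdeal R⁰).1 (hJN h1J)
  have : r = 1 := IsFractionRing.injective R K (by rw [hr1, map_one])
  exact hN ((Ideal.eq_top_iff_one N).2 (this ▸ hr))

theorem IsCliffordRegular.isMaximalTIdeal (h : IsCliffordRegular R) {N : Ideal R}
    [hN : N.IsMaximal] (hN0 : N ≠ ⊥) : IsMaximalTIdeal N := by
  refine ⟨⟨hN.ne_top, coeIdeal_ne_zero.2 hN0, Set.Subset.antisymm ?_ ?_⟩,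
    fun I hI hNI => (hN.eq_of_le hI.1 hNI).ge⟩
  · rintro x ⟨J, hJ, hfg, hJN, hx⟩
    have hJ1 : J ≤ 1 := hJN.trans coeIdeal_le_one
    have hxR : x ∈ (1 : FractionalIdeal R⁰ K) := by
      have := (mem_inv_iff (inv_ne_zero_of_ne_zero hJ)).1 hx 1
        ((mem_inv_iff hJ).2 fun y hy => by rw [one_mul]; exact hJ1 hy)
      rwa [mul_one] at this
    obtain ⟨r, rfl⟩ := (mem_one_iff R⁰).1 hxR
    by_contra hrN
    have hrN' : r ∉ N := fun hr => hrN (mem_coeIdeal_of_mem R⁰ hr)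
    obtain ⟨s, hs⟩ := hN.exists_inv hrN'
    obtain ⟨n, hn, hsn⟩ := hs
    have hnK := mem_coeIdeal_of_mem (P := K) R⁰ hn
    -- With `s * r + n = 1`, adjoining `n ∈ N` keeps the ideal finitely generated inside `N` but
    -- forces `1` into its `v`-closure.
    let J' : FractionalIdeal R⁰ K := J ⊔ spanSingleton R⁰ (algebraMap R K n)
    have hJJ' : J ≤ J' := le_sup_left
    have hJ' : J' ≠ 0 := fun h0 => hJ (le_bot_iff.1 (hJJ'.trans h0.le))
    have hJ'N : J' ≤ N := sup_le hJN (spanSingleton_le_iff_mem.2 hnK)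
    refine one_notMem_vClosure h hN.ne_top hJ' ?_ hJ'N ?_
    · rw [coe_sup, coe_spanSingleton]
      exact hfg.sup (Submodule.fg_span_singleton _)
    · have hinv := inv_ne_zero_of_ne_zero hJ'
      have h2 := (vClosure J' : Submodule R K).smul_mem s (vClosure_mono hJ hJ' hinv hJJ' hx)
      have h3 : algebraMap R K n ∈ vClosure J' := le_vClosure hJ' hinv
        ((le_sup_right : _ ≤ J') (mem_spanSingleton_self _ _))
      have h4 := (vClosure J' : Submodule R K).add_mem h2 h3
      rwa [Algebra.smul_def, ← map_mul, ← map_add, hsn, map_one] at h4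
  · intro x hx
    obtain ⟨a, ha, ha0⟩ := N.exists_mem_ne_zero_of_ne_bot hN0
    have haK := mem_coeIdeal_of_mem (P := K) R⁰ ha
    -- The generator `a` keeps `J` nonzero even when `x = 0`.
    let J : FractionalIdeal R⁰ K :=
      spanSingleton R⁰ (algebraMap R K a) ⊔ spanSingleton R⁰ x
    have hJ : J ≠ 0 := fun h0 => ha0 (by
      have := le_bot_iff.1 ((le_sup_left : spanSingleton R⁰ (algebraMap R K a) ≤ J).trans h0.le)
      exact (FaithfulSMul.algebraMap_eq_zero_iff R K).1 (spanSingleton_eq_zero_iff.1 this))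
    refine ⟨J, hJ, ?_, sup_le (spanSingleton_le_iff_mem.2 haK) (spanSingleton_le_iff_mem.2 hx),
      le_vClosure hJ (inv_ne_zero_of_ne_zero hJ)
        ((le_sup_right : _ ≤ J) (mem_spanSingleton_self _ _))⟩
    rw [coe_sup, coe_spanSingleton, coe_spanSingleton]
    exact (Submodule.fg_span_singleton _).sup (Submodule.fg_span_singleton _)

/-! ### Clifford regular `t`-locally Noetherian domains -/

theorem IsCliffordRegular.exists_regular (h : IsCliffordRegular R) {M : Ideal R} (hM : M ≠ ⊥) :
    ∃ J : Submodule R K, IsLocalization.coeSubmodule K M * (IsLocalization.coeSubmodule K M * J) =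
      IsLocalization.coeSubmodule K M := by
  obtain ⟨J, hJ⟩ := isCliffordRegular_iff_ideal.1 h M hM
  refine ⟨J, ?_⟩
  have hM' : IsLocalization.coeSubmodule K M = ((M : FractionalIdeal R⁰ K) : Submodule R K) := rfl
  rw [hM', ← coe_mul, ← coe_mul, hJ]

/-- The local lemmas need a ring between `R` and `K`, so `R_M` is replaced by its copy inside `K`.
-/
theorem IsTLocallyNoetherian.isNoetherianRing_ofField (hR : IsTLocallyNoetherian R)
    (h : IsCliffordRegular R) {M : Ideal R} [M.IsMaximal] (hM : M ≠ ⊥) :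
    IsNoetherianRing
      (Localization.subalgebra.ofField K M.primeCompl M.primeCompl_le_nonZeroDivisors) := by
  have := hR M (h.isMaximalTIdeal hM)
  exact isNoetherianRing_of_ringEquiv (Localization.AtPrime M)
    (IsLocalization.algEquiv M.primeCompl (Localization.AtPrime M)
      (Localization.subalgebra.ofField K M.primeCompl
        M.primeCompl_le_nonZeroDivisors)).toRingEquiv

theorem IsTLocallyNoetherian.isMaximal_of_isPrime (hR : IsTLocallyNoetherian R)
    (h : IsCliffordRegular R) {P : Ideal R} [hP : P.IsPrime] (hP0 : P ≠ ⊥) : P.IsMaximal := by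
  obtain ⟨M, hM, hPM⟩ := Ideal.exists_le_maximal P hP.ne_top
  have hM0 : M ≠ ⊥ := fun h0 => hP0 (le_bot_iff.1 (h0 ▸ hPM))
  obtain ⟨J, hJ⟩ := h.exists_regular hM0
  have := hR.isNoetherianRing_ofField h hM0
  rwa [prime_eq_of_le_of_regular (Localization.subalgebra.ofField K M.primeCompl
    M.primeCompl_le_nonZeroDivisors) hM0 hJ hP0 hPM]

/-- By Cohen's theorem nonzero primes suffice; these are maximal, so `Ideal.fg_of_regular` covers
them. -/
theorem IsTLocallyNoetherian.isNoetherianRing (hR : IsTLocallyNoetherian R)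
    (h : IsCliffordRegular R) : IsNoetherianRing R := by
  refine IsNoetherianRing.of_prime_ne_bot fun P hP hP0 => ?_
  have hPm := hR.isMaximal_of_isPrime h hP0
  obtain ⟨J, hJ⟩ := h.exists_regular hP0
  have := hR.isNoetherianRing_ofField h hP0
  exact Ideal.fg_of_regular (Localization.subalgebra.ofField K P.primeCompl
    P.primeCompl_le_nonZeroDivisors) hP0 hJ

theorem IsTLocallyNoetherian.ringKrullDim_eq_one (hR : IsTLocallyNoetherian R)
    (h : IsCliffordRegular R) (hF : ¬ IsField R) : ringKrullDim R = 1 := by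
  have : Ring.KrullDimLE 1 R :=
    Ring.krullDimLE_one_iff_of_noZeroDivisors.2 fun P hP0 hP => hR.isMaximal_of_isPrime h hP0
  refine eq_of_le_of_not_lt ?_ fun h' => hF ?_
  · rw [← Nat.cast_one, ← Ring.krullDimLE_iff]
    infer_instance
  · have h'' : ringKrullDim R ≤ 0 := Order.le_of_lt_succ h'
    rw [← Nat.cast_zero, ← Ring.krullDimLE_iff] at h''
    exact Ring.KrullDimLE.isField_of_isDomain

end Regularity

theorem theorem4p2 (R : Type*) [CommRing R] [IsDomain R] (hR : IsTLocallyNoetherian R) :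
    (IsCliffordRegular R ↔ IsStableDomain R) ∧
    (IsBooleRegular R ↔ IsStronglyStableDomain R) ∧
    (IsCliffordRegular R ∨ IsBooleRegular R ∨ IsStableDomain R ∨ IsStronglyStableDomain R →
      IsField R ∨ (IsNoetherianRing R ∧ ringKrullDim R = 1)) := by
  refine ⟨⟨fun h => ?_, IsStableDomain.isCliffordRegular⟩,
    ⟨fun h => ?_, IsStronglyStableDomain.isBooleRegular⟩, fun h => ?_⟩
  · have := hR.isNoetherianRing h
    exact h.isStableDomain
  · have := hR.isNoetherianRing h.isCliffordRegular
    exact h.isStronglyStableDomain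
  · have hC : IsCliffordRegular R := by
      rcases h with h | h | h | h
      exacts [h, h.isCliffordRegular, h.isCliffordRegular, h.isBooleRegular.isCliffordRegular]
    exact or_iff_not_imp_left.2 fun hF =>
      ⟨hR.isNoetherianRing hC, hR.ringKrullDim_eq_one hC hF⟩
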